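/- Theorem (Refinement for Large Games). \label{theorem:largegames} Consider a finite normal-form game with players $[n] = \{1,\dots,n\}$, where player $i$ has a nonempty finite action set $\mathcal{A}_i$ with $m_i = |\mathcal{A}_i|$ actions and utility $u_i : \prod_{j} \mathcal{A}_j \to [-1,1]$. Write $\Delta(\mathcal{A}_i)$ for the probability simplex over $\mathcal{A}_i$. The game is played repeatedly; at time $t = 0,1,2,\dots$ player $i$ uses a mixed strategy $x_i^{(t)} \in \Delta(\mathcal{A}_i)$ and observes the utility vector $u_i^{(t)}[a] = \mathbb{E}_{a_{-i} \sim x_{-i}^{(t)}}[u_i(a, a_{-i})]$, $a \in \mathcal{A}_i$ (time $0$ only serves for initialization). The swap regret of player $i$ is $$\mathrm{SwapReg}_i^T = \max_{\phi} \sum_{t=1}^T \langle \phi(x_i^{(t)}), u_i^{(t)} \rangle - \sum_{t=1}^T \langle x_i^{(t)}, u_i^{(t)} \rangle,$$ the maximum being over all linear maps $\phi$ that map $\Delta(\mathcal{A}_i)$ to itself. OFTRL with log-barrier regularization and learning rate $\eta > 0$, on utility vectors $w^{(0)}, w^{(1)}, \dots \in \mathbb{R}^{\mathcal{A}}$, produces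 the points $y^{(0)} = \arg\min_y \mathcal{R}(y)$ and, for $t \ge 1$, $$y^{(t)} = \arg\max_y \Big\{ \eta \Big\langle y, w^{(t-1)} + \sum_{\tau=1}^{t-1} w^{(\tau)} \Big\rangle - \mathcal{R}(y) \Big\}, \qquad \mathcal{R}(y) = -\sum_{a \in \mathcal{A}} \log y[a],$$ over the relative interior of $\Delta(\mathcal{A})$. A player $i$ uses BM-OFTRL-LogBar with learning rate $\eta$ if, for each $a \in \mathcal{A}_i$, a separate copy of this algorithm is run on the utility vectors $x_i^{(t)}[a]\, u_i^{(t)}$, $t \ge 0$, its point at time $t$ is row $a$ of the row-stochastic matrix $Q_i^{(t)}$, and $x_i^{(t)}$ is a stationary distribution of $Q_i^{(t)}$, i.e. $(Q_i^{(t)})^\top x_i^{(t)} = x_i^{(t)}$. Assume that there are sets $\mathcal{N}_i \subseteq [n]$ such that $u_i$ depends only on player $i$'s own action and on the actions of the players in $\mathcal{N}_i$, and an integer $c \ge 1$ with $|\mathcal{N}_i| \le c \le n-1$ and $|\{ j \ne i : i \in \mathcal{N}_j \}| \le c$ for all $i \in [n]$. Let $T \ge 2$. (1) If all players use BM-OFTRL-LogBar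 with $\eta = \dfrac{1}{128\, c \max_{j} \sqrt{m_j}}$, then $$\sum_{i=1}^n \mathrm{SwapReg}_i^T \le 256\, c \max_{j} \sqrt{m_j}\, \sum_{j=1}^n m_j^2 \, \log T.$$ (2) One has $\dfrac{1}{128 \sqrt{cn} \max_{j} \sqrt{m_j}} \le \dfrac{1}{128\, c \max_{j} \sqrt{m_j}}$. If all players use BM-OFTRL-LogBar with $\eta = \dfrac{1}{128 \sqrt{cn} \max_{j} \sqrt{m_j}}$, then for every player $i$ $$\mathrm{SwapReg}_i^T \le 256 \max_{j} \sqrt{m_j} \left( \sqrt{cn}\, m_i^2 + \sqrt{\frac{c}{n}} \sum_{j=1}^n m_j^2 \right) \log T;$$ in particular, if $m_j = m$ for all $j \in [n]$, then $\mathrm{SwapReg}_i^T \le 512 \sqrt{cn}\, m^{5/2} \log T$. -/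

import Mathlib

open scoped Matrix

noncomputable section

namespace LargeGames

/-! Online learning on the probability simplex `stdSimplex ℝ A` over a finite set `A`. -/

section Learning

variable {A : Type*} [Fintype A]

/-- The relative interior of the probability simplex, i.e. the domain of the log-barrier
(the log-barrier is `+∞` on the relative boundary). -/
def openSimplex (A : Type*) [Fintype A] : Set (A → ℝ) :=
  {x | (∀ r, 0 < x r) ∧ ∑ r, x r = 1}

/-- The log-barrier regularizer `R(x) = -∑ r, log x[r]` of the simplex. -/
def logBarrier (x : A → ℝ) : ℝ := -∑ r, Real.log (x r)

/-- The sequence of strategies `x` is produced by optimistic follow-the-regularized-leader with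
learning rate `η` and log-barrier regularization, on the utility vectors `u 1, u 2, …`, where
the prediction for round `t + 1` is the utility `u t` (so `u 0` serves only as a prediction).
* `x 0` minimizes the regularizer;
* `x (t + 1)` maximizes `y ↦ η ⟨y, u t + ∑_{τ = 1}^{t} u τ⟩ - R(y)`. -/
def IsOFTRLLogBar (η : ℝ) (u x : ℕ → A → ℝ) : Prop :=
  (x 0 ∈ openSimplex A ∧ IsMinOn logBarrier (openSimplex A) (x 0)) ∧
  ∀ t : ℕ, x (t + 1) ∈ openSimplex A ∧
    IsMaxOn (fun y : A → ℝ => η * (y ⬝ᵥ (u t + ∑ τ ∈ Finset.Icc 1 t, u τ)) - logBarrier y)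
      (openSimplex A) (x (t + 1))

/-- The sequence of mixed strategies `x` is produced by BM-OFTRL-LogBar with learning rate `η`
when the observed utility vectors are `u`: the Blum--Mansour master algorithm runs one copy of
OFTRL with log-barrier regularization for every action `a`, which produces the rows `Q t a` of a
stochastic matrix; at each round it plays a stationary distribution `x t` of `Q t`, and it
forwards to the copy of action `a` the utility vector `x t a • u t`. -/
def IsBMOFTRLLogBar (η : ℝ) (u x : ℕ → A → ℝ) : Prop :=
  ∃ Q : ℕ → Matrix A A ℝ,
    (∀ a : A, IsOFTRLLogBar η (fun t => x t a • u t) (fun t => Q t a)) ∧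
    ∀ t : ℕ, x t ∈ stdSimplex ℝ A ∧ (Q t)ᵀ *ᵥ x t = x t

/-- The values `∑_{t = 1}^{T} ⟨φ (x t), u t⟩`, for `φ` a linear transformation of the simplex. -/
def swapValues (T : ℕ) (u x : ℕ → A → ℝ) : Set ℝ :=
  {r | ∃ φ : (A → ℝ) →ₗ[ℝ] (A → ℝ), Set.MapsTo φ (stdSimplex ℝ A) (stdSimplex ℝ A) ∧
    r = ∑ t ∈ Finset.Icc 1 T, φ (x t) ⬝ᵥ u t}

/-- The swap regret `SwapReg^T`: the gap to the best linear transformation of the simplex. -/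
def swapRegret (T : ℕ) (u x : ℕ → A → ℝ) : ℝ :=
  sSup (swapValues T u x) - ∑ t ∈ Finset.Icc 1 T, x t ⬝ᵥ u t

/-- The supremum in the definition of the swap regret is always a maximum. -/
theorem isGreatest_sSup_swapValues [Nonempty A] (T : ℕ) (u x : ℕ → A → ℝ) :
    IsGreatest (swapValues T u x) (sSup (swapValues T u x)) := by
  classical
  let V : A → A → ℝ := fun a b => ∑ t ∈ Finset.Icc 1 T, x t a * u t b
  have hval : ∀ φ : (A → ℝ) →ₗ[ℝ] (A → ℝ),
      ∑ t ∈ Finset.Icc 1 T, φ (x t) ⬝ᵥ u t = ∑ a, ∑ b, φ (Pi.single a 1) b * V a b := by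
    intro φ
    have h1 : ∀ t b, φ (x t) b = ∑ a, x t a * φ (Pi.single a 1) b := by
      intro t b
      have h2 : x t = ∑ a, x t a • (Pi.single a (1 : ℝ) : A → ℝ) := by
        ext b
        simp [Finset.sum_apply, Pi.single_apply]
      conv_lhs => rw [h2]
      simp only [map_sum, map_smul, Finset.sum_apply, Pi.smul_apply, smul_eq_mul]
    simp only [dotProduct, h1, V, Finset.mul_sum, Finset.sum_mul]
    have h4 : ∀ t, ∑ b, ∑ a, x t a * φ (Pi.single a 1) b * u t b =
        ∑ a, ∑ b, x t a * φ (Pi.single a 1) b * u t b := fun t => Finset.sum_comm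
    simp only [h4]
    rw [Finset.sum_comm]
    refine Finset.sum_congr rfl fun a _ => ?_
    rw [Finset.sum_comm]
    exact Finset.sum_congr rfl fun b _ => Finset.sum_congr rfl fun t _ => by ring
  choose best hbest using fun a => Finite.exists_max (V a)
  let ψ : (A → ℝ) →ₗ[ℝ] (A → ℝ) := ∑ a, (LinearMap.proj a).smulRight (Pi.single (best a) 1)
  have hψ : ∀ y b, ψ y b = ∑ a, y a * (Pi.single (best a) (1 : ℝ) : A → ℝ) b := by
    intro y b
    simp [ψ, LinearMap.sum_apply, Finset.sum_apply]
  have hmem : ∑ t ∈ Finset.Icc 1 T, ψ (x t) ⬝ᵥ u t ∈ swapValues T u x := by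
    refine ⟨ψ, fun y hy => ⟨fun b => ?_, ?_⟩, rfl⟩
    · rw [hψ]
      refine Finset.sum_nonneg fun a _ => mul_nonneg (hy.1 a) ?_
      by_cases h : b = best a
      · subst h; simp
      · simp [h]
    · simp only [hψ]
      rw [Finset.sum_comm]
      simp [← Finset.mul_sum, hy.2]
  have hgr : IsGreatest (swapValues T u x) (∑ t ∈ Finset.Icc 1 T, ψ (x t) ⬝ᵥ u t) := by
    refine ⟨hmem, ?_⟩
    rintro r ⟨φ, hφ, rfl⟩
    rw [hval φ, hval ψ]
    refine Finset.sum_le_sum fun a _ => ?_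
    have hs := hφ (single_mem_stdSimplex ℝ a)
    have hR : ∑ b, ψ (Pi.single a 1) b * V a b = V a (best a) := by
      have h3 : ∀ b, ψ (Pi.single a 1) b = (Pi.single (best a) (1 : ℝ) : A → ℝ) b := by
        intro b
        rw [hψ, Finset.sum_eq_single a]
        · simp
        · intro a' _ h
          simp [h]
        · simp
      simp [h3, Pi.single_apply]
    rw [hR]
    calc ∑ b, φ (Pi.single a 1) b * V a b
        ≤ ∑ b, φ (Pi.single a 1) b * V a (best a) :=
          Finset.sum_le_sum fun b _ => mul_le_mul_of_nonneg_left (hbest a b) (hs.1 b)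
      _ = V a (best a) := by rw [← Finset.sum_mul, hs.2, one_mul]
  rw [hgr.csSup_eq]
  exact hgr

end Learning

/-! Finite games in normal form. -/

section Games

variable {n : ℕ} {A : Fin n → Type*} [∀ i, Fintype (A i)]

/-- The utility vector of player `i` when the players use the mixed strategies `x`; its
coordinate at `a` is `u_i(a; x_{-i})`, the expectation of `u_i(a, b)` over action profiles `b`
of the other players drawn from the product distribution of their mixed strategies. -/
def utilityVector (u : Fin n → (∀ j, A j) → ℝ) (x : ∀ j, A j → ℝ) (i : Fin n) : A i → ℝ :=
  fun a => ∑ b : (∀ j : {j : Fin n // j ≠ i}, A j),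
    (∏ j : {j : Fin n // j ≠ i}, x j (b j)) * u i ((Equiv.piSplitAt i A).symm (a, b))

/-- The utility vectors observed by player `i` along the sequences of strategies `x`. -/
def feedback (u : Fin n → (∀ j, A j) → ℝ) (x : ∀ j, ℕ → A j → ℝ) (i : Fin n) : ℕ → A i → ℝ :=
  fun t => utilityVector u (fun j => x j t) i

/-- All players use BM-OFTRL-LogBar with learning rate `η` in the repeated game `u`. -/
def AllPlayersUseBMOFTRLLogBar (η : ℝ) (u : Fin n → (∀ j, A j) → ℝ)
    (x : ∀ j, ℕ → A j → ℝ) : Prop :=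
  ∀ i, IsBMOFTRLLogBar η (feedback u x i) (x i)

/-- The swap regret of player `i` in the repeated game `u` up to time `T`. -/
def playerSwapRegret (T : ℕ) (u : Fin n → (∀ j, A j) → ℝ) (x : ∀ j, ℕ → A j → ℝ)
    (i : Fin n) : ℝ :=
  swapRegret T (feedback u x i) (x i)

/-- `max_j √m_j`, where `m_j` is the number of actions of player `j`. -/
def maxSqrtActions (A : Fin n → Type*) [∀ i, Fintype (A i)] : ℝ :=
  ⨆ j, √(Fintype.card (A j) : ℝ)

end Games

end LargeGames

end

open LargeGames

/-! Swap regret is nonnegative, because the identity is an admissible transformation. So a bound on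
the sum of all regrets in which the path lengths appear with a negative sign also bounds the path
lengths, and hence the utility variation that each player faces.

The single-player bound is `IsBMOFTRLLogBar.swapRegret_le`: with m actions and utilities moving by
at most d_t, the regret is at most 2 m² log T / η + 16 η ∑ d_t² − ∑ ‖x^(t+1) − x^(t)‖₁² / (512 η m).
Its negative term has two sources. Maximizers lie in the open simplex, so the optimality conditions
are equalities, and telescoping them leaves log-barrier Bregman divergences between successive rows;
these dominate the squared relative movement of the rows. Then `sum_abs_stationary_sub_le` shows
that the stationary distribution moves in ℓ¹ by at most four times the summed relative movement of
the rows, whatever the mixing time.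

In the game, d_t is at most the total ℓ¹ movement of the neighbours. Cauchy–Schwarz over at most c
neighbours and double counting of neighbour pairs lose a factor c each. With M = max √m_j, P the
total path length and η = 1/(128 κ M), κ ≥ c, the positive term is at most κP/(8M), half of the
negative one. Taking κ = c gives the bound on the sum; κ = √(cn) balances the individual bounds. -/

open scoped Matrix

namespace LargeGames

/-! ### Geometry of the log-barrier and stability of OFTRL -/

section Learning

variable {A : Type*} [Fintype A]

/-- The Bregman divergence of the log-barrier. -/
noncomputable def logBregman (z y : A → ℝ) : ℝ := ∑ r, (z r / y r - 1 - Real.log (z r / y r))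

/-- The local norm of `z - y` at `y` induced by the log-barrier. -/
noncomputable def localDist (z y : A → ℝ) : ℝ := √(∑ r, (z r / y r - 1) ^ 2)

theorem localDist_nonneg (z y : A → ℝ) : 0 ≤ localDist z y := Real.sqrt_nonneg _

theorem sq_localDist (z y : A → ℝ) : localDist z y ^ 2 = ∑ r, (z r / y r - 1) ^ 2 :=
  Real.sq_sqrt (Finset.sum_nonneg fun _ _ => sq_nonneg _)

theorem abs_div_sub_one_le_localDist (z y : A → ℝ) (r : A) :
    |z r / y r - 1| ≤ localDist z y := by
  refine Real.abs_le_sqrt ?_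
  exact Finset.single_le_sum (f := fun r => (z r / y r - 1) ^ 2)
    (fun _ _ => sq_nonneg _) (Finset.mem_univ r)

/-- First-order optimality of a maximizer of a linear function minus the log-barrier. -/
theorem first_order_of_isMaxOn {η : ℝ} {g y z : A → ℝ} (hy : y ∈ openSimplex A)
    (hmax : IsMaxOn (fun y : A → ℝ => η * (y ⬝ᵥ g) - logBarrier y) (openSimplex A) y)
    (hz : z ∈ openSimplex A) :
    η * ((z - y) ⬝ᵥ g) + ∑ r, (z r / y r - 1) = 0 := by
  have hd : HasDerivAt (fun s : ℝ => η * ((y + s • (z - y)) ⬝ᵥ g) - logBarrier (y + s • (z - y)))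
      (η * ((z - y) ⬝ᵥ g) - -∑ r, (z r - y r) / y r) 0 := by
    refine HasDerivAt.sub (HasDerivAt.const_mul _ ?_) (HasDerivAt.neg (HasDerivAt.fun_sum ?_))
    · simp only [add_dotProduct, smul_dotProduct, smul_eq_mul]
      simpa using ((hasDerivAt_id (0 : ℝ)).mul_const ((z - y) ⬝ᵥ g)).const_add (y ⬝ᵥ g)
    · intro r _
      have h1 : HasDerivAt (fun s : ℝ => (y + s • (z - y)) r) (z r - y r) 0 := by
        simpa using ((hasDerivAt_id (0 : ℝ)).mul_const (z r - y r)).const_add (y r)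
      have h2 := h1.log (by simpa using (hy.1 r).ne')
      simpa using h2
  have hloc : IsLocalMax
      (fun s : ℝ => η * ((y + s • (z - y)) ⬝ᵥ g) - logBarrier (y + s • (z - y))) 0 := by
    -- The line through y and z stays in the open simplex on both sides of s = 0, so optimality
    -- gives an equality rather than an inequality.
    have hpos : ∀ᶠ s : ℝ in nhds 0, ∀ r, 0 < (y + s • (z - y)) r := by
      refine Filter.eventually_all.2 fun r => ?_
      have hc : Continuous fun s : ℝ => (y + s • (z - y)) r := by
        simp only [Pi.add_apply, Pi.smul_apply, smul_eq_mul]; fun_prop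
      exact hc.continuousAt.eventually_const_lt (by simpa using hy.1 r)
    filter_upwards [hpos] with s hs
    have hmem : y + s • (z - y) ∈ openSimplex A := by
      refine ⟨hs, ?_⟩
      simp only [Pi.add_apply, Pi.smul_apply, Pi.sub_apply, smul_eq_mul, Finset.sum_add_distrib,
        ← Finset.mul_sum, Finset.sum_sub_distrib, hy.2, hz.2]
      simp
    simpa using hmax hmem
  have h0 := hloc.hasDerivAt_eq_zero hd
  have h1 : ∑ r, (z r / y r - 1) = ∑ r, (z r - y r) / y r :=
    Finset.sum_congr rfl fun r _ => by
      have := (hy.1 r).ne'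
      field_simp
  rw [h1]
  linarith

theorem logBregman_add_eq {y z : A → ℝ} (hy : ∀ r, 0 < y r) (hz : ∀ r, 0 < z r) :
    logBregman z y = ∑ r, (z r / y r - 1) + logBarrier z - logBarrier y := by
  simp only [logBregman, logBarrier, Finset.sum_sub_distrib]
  have : ∀ r, Real.log (z r / y r) = Real.log (z r) - Real.log (y r) := fun r =>
    Real.log_div (hz r).ne' (hy r).ne'
  simp only [this, Finset.sum_sub_distrib]
  ring

/-- The value of the maximizer exceeds any other value exactly by a Bregman divergence. -/
theorem eq_add_logBregman_of_isMaxOn {η : ℝ} {g y z : A → ℝ} (hy : y ∈ openSimplex A)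
    (hmax : IsMaxOn (fun y : A → ℝ => η * (y ⬝ᵥ g) - logBarrier y) (openSimplex A) y)
    (hz : z ∈ openSimplex A) :
    η * (y ⬝ᵥ g) - logBarrier y = η * (z ⬝ᵥ g) - logBarrier z + logBregman z y := by
  have h := first_order_of_isMaxOn hy hmax hz
  rw [logBregman_add_eq hy.1 hz.1]
  rw [sub_dotProduct] at h
  linarith

/-- With q = √(1 + d), the bound log q ≤ q − 1 gives d − log(1 + d) ≥ (q − 1)², while d² = (q −
1)²(q + 1)² and (q + 1)² ≤ 6. -/
theorem sq_div_six_le_sub_log {d : ℝ} (h1 : -1 < d) (h2 : d ≤ 1) :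
    d ^ 2 / 6 ≤ d - Real.log (1 + d) := by
  have hs : 0 < 1 + d := by linarith
  have h3 : Real.log (1 + d) = 2 * Real.log (√(1 + d)) := by
    rw [Real.log_sqrt hs.le]; ring
  set q := √(1 + d) with hq
  have hq0 : 0 < q := Real.sqrt_pos.2 hs
  have hq2 : q ^ 2 = 1 + d := Real.sq_sqrt hs.le
  have h4 := Real.log_le_sub_one_of_pos hq0
  have hd : d = q ^ 2 - 1 := by linarith
  have hq1 : q ≤ 3 / 2 := by nlinarith
  have hqs : (1 + q) ^ 2 ≤ 6 := by nlinarith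
  have h5 : d ^ 2 = (q - 1) ^ 2 * (1 + q) ^ 2 := by rw [hd]; ring
  nlinarith [mul_le_mul_of_nonneg_left hqs (sq_nonneg (q - 1))]

theorem sq_localDist_div_six_le_logBregman {z y : A → ℝ} (hy : ∀ r, 0 < y r) (hz : ∀ r, 0 < z r)
    (h : localDist z y ≤ 1) : localDist z y ^ 2 / 6 ≤ logBregman z y := by
  rw [sq_localDist, Finset.sum_div]
  refine Finset.sum_le_sum fun r _ => ?_
  have h1 := (abs_le.1 ((abs_div_sub_one_le_localDist z y r).trans h)).2
  have h2 := div_pos (hz r) (hy r)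
  have h3 := sq_div_six_le_sub_log (by linarith) h1
  rwa [add_sub_cancel] at h3

/-- The utility vector with respect to which the iterate `t` of OFTRL is optimal. -/
def optimisticSum (w : ℕ → A → ℝ) : ℕ → A → ℝ
  | 0 => 0
  | t + 1 => w t + ∑ τ ∈ Finset.Icc 1 t, w τ

theorem IsOFTRLLogBar.mem {η : ℝ} {w y : ℕ → A → ℝ} (h : IsOFTRLLogBar η w y) (t : ℕ) :
    y t ∈ openSimplex A := by
  cases t with
  | zero => exact h.1.1
  | succ t => exact (h.2 t).1

theorem IsOFTRLLogBar.isMaxOn {η : ℝ} {w y : ℕ → A → ℝ} (h : IsOFTRLLogBar η w y) (t : ℕ) :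
    IsMaxOn (fun y : A → ℝ => η * (y ⬝ᵥ optimisticSum w t) - logBarrier y)
      (openSimplex A) (y t) := by
  cases t with
  | zero =>
    intro z hz
    have := h.1.2 hz
    simpa [optimisticSum] using this
  | succ t => exact (h.2 t).2

/-- The change of the objective of OFTRL after round `t`. -/
def utilityStep (w : ℕ → A → ℝ) : ℕ → A → ℝ
  | 0 => w 0
  | t + 1 => w (t + 1) + (w (t + 1) - w t)

theorem optimisticSum_succ {A : Type*} (w : ℕ → A → ℝ) (t : ℕ) :
    optimisticSum w (t + 1) = optimisticSum w t + utilityStep w t := by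
  cases t with
  | zero => simp [optimisticSum, utilityStep]
  | succ t =>
    simp only [optimisticSum, utilityStep, Finset.sum_Icc_succ_top (Nat.le_add_left 1 t)]
    abel

/-- The optimal value of OFTRL, expanded along the iterates. -/
theorem IsOFTRLLogBar.value_eq {η : ℝ} {w y : ℕ → A → ℝ} (h : IsOFTRLLogBar η w y) (T : ℕ) :
    η * (y (T + 1) ⬝ᵥ optimisticSum w (T + 1)) - logBarrier (y (T + 1)) =
      η * ∑ t ∈ Finset.range T, y (t + 1) ⬝ᵥ w (t + 1) + η * (y (T + 1) ⬝ᵥ w T)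
        - logBarrier (y 0) - logBregman (y 1) (y 0)
        + ∑ t ∈ Finset.range T, (η * ((y (t + 2) - y (t + 1)) ⬝ᵥ (w (t + 1) - w t))
          - logBregman (y (t + 2)) (y (t + 1))) := by
  induction T with
  | zero =>
    have h0 := eq_add_logBregman_of_isMaxOn (h.mem 0) (h.isMaxOn 0) (h.mem 1)
    simp [optimisticSum] at h0 ⊢
    linarith
  | succ T ih =>
    have h1 := eq_add_logBregman_of_isMaxOn (h.mem (T + 1)) (h.isMaxOn (T + 1)) (h.mem (T + 2))
    rw [Finset.sum_range_succ, Finset.sum_range_succ, optimisticSum_succ w (T + 1)]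
    simp only [dotProduct_add, utilityStep, sub_dotProduct, dotProduct_sub] at ih h1 ⊢
    linarith

theorem sum_Icc_one_eq_sum_range {M : Type*} [AddCommMonoid M] (f : ℕ → M) (T : ℕ) :
    ∑ t ∈ Finset.Icc 1 T, f t = ∑ t ∈ Finset.range T, f (t + 1) := by
  induction T with
  | zero => simp
  | succ T ih => rw [Finset.sum_Icc_succ_top (Nat.le_add_left 1 T), ih, Finset.sum_range_succ]

/-- The regret of OFTRL with log-barrier regularization. -/
theorem IsOFTRLLogBar.regret_le {η : ℝ} {w y : ℕ → A → ℝ} (h : IsOFTRLLogBar η w y) (T : ℕ)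
    {z : A → ℝ} (hz : z ∈ openSimplex A) :
    η * ∑ t ∈ Finset.range T, (z ⬝ᵥ w (t + 1) - y (t + 1) ⬝ᵥ w (t + 1)) ≤
      logBarrier z - logBarrier (y 0) + η * ((y (T + 1) - z) ⬝ᵥ w T)
        - logBregman (y 1) (y 0)
        + ∑ t ∈ Finset.range T, (η * ((y (t + 2) - y (t + 1)) ⬝ᵥ (w (t + 1) - w t))
          - logBregman (y (t + 2)) (y (t + 1))) := by
  have h1 := h.isMaxOn (T + 1) hz
  have h2 : optimisticSum w (T + 1) = w T + ∑ t ∈ Finset.range T, w (t + 1) := by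
    rw [← sum_Icc_one_eq_sum_range]; rfl
  simp only [Set.mem_ofPred_eq, h.value_eq T] at h1
  rw [h2, dotProduct_add, dotProduct_sum] at h1
  rw [Finset.sum_sub_distrib, sub_dotProduct]
  linarith

theorem sum_mul_sub_eq {y z k : A → ℝ} (hy : ∀ r, 0 < y r) :
    (z - y) ⬝ᵥ k = ∑ r, (z r / y r - 1) * (y r * k r) :=
  Finset.sum_congr rfl fun r _ => by
    have := (hy r).ne'
    simp only [Pi.sub_apply]
    field_simp

/-- Successive iterates of OFTRL are close in the local norm. -/
theorem localDist_le_of_isMaxOn {η K : ℝ} {g k y z : A → ℝ}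
    (hy : y ∈ openSimplex A) (hz : z ∈ openSimplex A)
    (hymax : IsMaxOn (fun y : A → ℝ => η * (y ⬝ᵥ g) - logBarrier y) (openSimplex A) y)
    (hzmax : IsMaxOn (fun y : A → ℝ => η * (y ⬝ᵥ (g + k)) - logBarrier y) (openSimplex A) z)
    (hk : ∀ r, |η * k r| ≤ K) (hK : K ≤ 1 / 2) :
    localDist z y ≤ 2 * K := by
  -- Adding the two optimality conditions, each tested against the other point, cancels g and leaves
  -- ∑ (z/y + y/z − 2) = η⟨z − y, k⟩.
  have h1 := first_order_of_isMaxOn hy hymax hz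
  have h2 := first_order_of_isMaxOn hz hzmax hy
  have h3 : η * ((y - z) ⬝ᵥ (g + k)) = - (η * ((z - y) ⬝ᵥ g)) - η * ((z - y) ⬝ᵥ k) := by
    simp only [dotProduct_add, sub_dotProduct]; ring
  set ν := localDist z y with hν
  have hν0 : 0 ≤ ν := localDist_nonneg z y
  have hab := abs_div_sub_one_le_localDist z y
  have h4 : η * ((z - y) ⬝ᵥ k) ≤ ν * K := by
    rw [sum_mul_sub_eq hy.1, Finset.mul_sum]
    calc ∑ r, η * ((z r / y r - 1) * (y r * k r)) ≤ ∑ r, y r * (ν * K) := by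
          refine Finset.sum_le_sum fun r _ => ?_
          have h5 : (z r / y r - 1) * (η * k r) ≤ ν * K := by
            refine (le_abs_self _).trans ?_
            rw [abs_mul]
            exact mul_le_mul (hab r) (hk r) (abs_nonneg _) hν0
          nlinarith [mul_le_mul_of_nonneg_left h5 (hy.1 r).le]
      _ = ν * K := by rw [← Finset.sum_mul, hy.2, one_mul]
  -- With q = z/y, each summand on the right is (q − 1)²/q, and q ≤ 1 + ν.
  have h6 : ν ^ 2 ≤ (1 + ν) * (∑ r, (z r / y r - 1) + ∑ r, (y r / z r - 1)) := by
    rw [hν, sq_localDist, ← hν, ← Finset.sum_add_distrib, Finset.mul_sum]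
    refine Finset.sum_le_sum fun r _ => ?_
    have hq : 0 < z r / y r := div_pos (hz.1 r) (hy.1 r)
    have hq2 : y r / z r = (z r / y r)⁻¹ := (inv_div _ _).symm
    rw [hq2]
    have hle := (abs_le.1 (hab r)).2
    generalize z r / y r = q at hq hle
    have h7 : q - 1 + (q⁻¹ - 1) = (q - 1) ^ 2 / q := by field_simp; ring
    rw [h7, mul_div_assoc', le_div_iff₀ hq]
    nlinarith [sq_nonneg (q - 1)]
  have h8 : ν ^ 2 ≤ (1 + ν) * (ν * K) := h6.trans
    (mul_le_mul_of_nonneg_left (by linarith) (by linarith))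
  rcases hν0.eq_or_lt with h0 | h0
  · rcases isEmpty_or_nonempty A with hA | ⟨⟨r⟩⟩
    · simpa using hy.2
    · have := (abs_nonneg _).trans (hk r)
      linarith
  · have h9 : ν ≤ (1 + ν) * K := by
      by_contra hcon
      nlinarith
    nlinarith

end Learning

end LargeGames

namespace LargeGames

/-! ### Perturbation of stationary distributions via Poisson's equation -/

section Stationary

variable {A : Type*} [Fintype A]

/-- Maximum principle: a function that is subharmonic away from `a` is maximal at `a`. -/
theorem le_of_subharmonic_off {P : A → A → ℝ} (hP : ∀ b c, 0 < P b c) (hP1 : ∀ b, ∑ c, P b c = 1)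
    (a : A) (g : A → ℝ) (hg : ∀ b, b ≠ a → g b ≤ ∑ c, P b c * g c) (b : A) : g b ≤ g a := by
  have : Nonempty A := ⟨a⟩
  obtain ⟨b₀, hb₀⟩ := Finite.exists_max g
  refine (hb₀ b).trans ?_
  by_cases hba : b₀ = a
  · rw [hba]
  have h1 : P b₀ a * (g b₀ - g a) ≤ ∑ c, P b₀ c * (g b₀ - g c) :=
    Finset.single_le_sum (f := fun c => P b₀ c * (g b₀ - g c))
      (fun c _ => mul_nonneg (hP _ _).le (sub_nonneg.2 (hb₀ c))) (Finset.mem_univ a)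
  simp only [mul_sub, Finset.sum_sub_distrib, ← Finset.sum_mul, hP1] at h1
  have h2 := hg b₀ hba
  nlinarith [hP b₀ a]

/-- If the source of Poisson's equation is dominated by the transition probabilities to `a`,
then the solution is close to its value at `a`. -/
theorem abs_sub_le_of_poisson {P : A → A → ℝ} (hP : ∀ b c, 0 < P b c)
    (hP1 : ∀ b, ∑ c, P b c = 1) (a : A) (f h : A → ℝ) (κ : ℝ) (hκ : 0 ≤ κ)
    (hf : ∀ b, f b - ∑ c, P b c * f c = h b) (hh : ∀ b, |h b| ≤ κ * P b a) (b : A) :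
    |f b - f a| ≤ κ := by
  classical
  have key : ∀ f h : A → ℝ, (∀ b, f b - ∑ c, P b c * f c = h b) →
      (∀ b, h b ≤ κ * P b a) → f b - f a ≤ κ := by
    intro f h hf hh
    -- Raising f by κ at a adds κ P(b, a) to the average seen from b, which pays for the source
    -- h(b); the maximum principle then applies.
    have := le_of_subharmonic_off hP hP1 a (fun b => f b + if b = a then κ else 0)
      (fun b hb => by
        simp only [hb, if_false, mul_add, Finset.sum_add_distrib, mul_ite, mul_zero,
          Finset.sum_ite_eq', Finset.mem_univ, if_true]
        linarith [hf b, hh b]) b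
    simp only [if_true] at this
    split_ifs at this <;> linarith
  rw [abs_le]
  have h1 := key f h hf fun b => (le_abs_self _).trans (hh b)
  have h2 := key (fun b => -f b) (fun b => -h b)
    (fun b => by simp only [mul_neg, Finset.sum_neg_distrib, ← hf b]; ring)
    fun b => (neg_le_abs _).trans (hh b)
  constructor <;> linarith

/-- Solvability of Poisson's equation for a chain with positive transition probabilities. -/
theorem exists_poisson_solution {P : A → A → ℝ} (hP : ∀ b c, 0 < P b c)
    (hP1 : ∀ b, ∑ c, P b c = 1) (p : A → ℝ) (hp1 : ∑ b, p b = 1)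
    (hpP : ∀ c, ∑ b, p b * P b c = p c) (h : A → ℝ) (hph : ∑ b, p b * h b = 0) :
    ∃ f : A → ℝ, ∀ b, f b - ∑ c, P b c * f c = h b := by
  -- I − P has the constants as kernel; adding the rank-one map f ↦ ⟨p, f⟩ makes it injective, hence
  -- surjective, and ⟨p, h⟩ = 0 makes the extra term vanish.
  let L : (A → ℝ) →ₗ[ℝ] (A → ℝ) :=
    { toFun := fun f b => f b - ∑ c, P b c * f c + ∑ c, p c * f c
      map_add' := fun f g => by
        ext b; simp only [Pi.add_apply, mul_add, Finset.sum_add_distrib]; ring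
      map_smul' := fun r f => by
        ext b
        simp only [Pi.smul_apply, smul_eq_mul, RingHom.id_apply, mul_add, mul_sub, Finset.mul_sum]
        congr 1
        · congr 1
          exact Finset.sum_congr rfl fun c _ => by ring
        · exact Finset.sum_congr rfl fun c _ => by ring }
  have hL : ∀ f b, L f b = f b - ∑ c, P b c * f c + ∑ c, p c * f c := fun _ _ => rfl
  have hpL : ∀ f, ∑ b, p b * L f b = ∑ c, p c * f c := by
    intro f
    have h1 : ∑ b, p b * ∑ c, P b c * f c = ∑ c, p c * f c := by
      simp only [Finset.mul_sum]
      rw [Finset.sum_comm]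
      refine Finset.sum_congr rfl fun c _ => ?_
      rw [← hpP c, Finset.sum_mul]
      exact Finset.sum_congr rfl fun b _ => by ring
    simp only [hL, mul_add, mul_sub, Finset.sum_add_distrib, Finset.sum_sub_distrib, h1,
      ← Finset.sum_mul, hp1]
    ring
  have hinj : Function.Injective L := by
    rw [← LinearMap.ker_eq_bot, LinearMap.ker_eq_bot']
    intro f hf
    have h0 : ∑ c, p c * f c = 0 := by rw [← hpL, hf]; simp
    have h1 : ∀ b, f b - ∑ c, P b c * f c = 0 := fun b => by
      have := hL f b
      rw [hf, h0] at this
      simpa using this.symm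
    have h2 : ∀ a b, f b = f a := fun a b => by
      have := abs_sub_le_of_poisson hP hP1 a f 0 0 le_rfl h1 (by simp) b
      exact sub_eq_zero.1 (abs_eq_zero.1 (le_antisymm this (abs_nonneg _)))
    ext a
    simp only [h2 a, ← Finset.sum_mul, hp1, one_mul] at h0
    simpa using h0
  obtain ⟨f, hf⟩ := LinearMap.injective_iff_surjective.1 hinj h
  have h0 : ∑ c, p c * f c = 0 := by rw [← hpL, hf, hph]
  refine ⟨f, fun b => ?_⟩
  rw [← hf, hL, h0, add_zero]

theorem pos_of_stationary {Q : A → A → ℝ} (hQ : ∀ a b, 0 < Q a b) {p : A → ℝ}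
    (hp : p ∈ stdSimplex ℝ A) (hpQ : ∀ b, ∑ a, p a * Q a b = p b) (b : A) : 0 < p b := by
  obtain ⟨a, ha⟩ : ∃ a, 0 < p a := by
    by_contra! hcon
    have := Finset.sum_nonpos fun a (_ : a ∈ Finset.univ) => hcon a
    rw [hp.2] at this
    linarith
  rw [← hpQ b]
  exact Finset.sum_pos' (fun c _ => mul_nonneg (hp.1 c) (hQ c b).le)
    ⟨a, Finset.mem_univ a, mul_pos ha (hQ a b)⟩

/-- The stationary distribution of a positive chain is stable under multiplicative
perturbations of the rows of the transition matrix. -/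
theorem sum_abs_stationary_sub_le {Q Q' : A → A → ℝ} {p p' μ : A → ℝ}
    (hQ : ∀ a b, 0 < Q a b) (hQ1 : ∀ a, ∑ b, Q a b = 1) (hQ1' : ∀ a, ∑ b, Q' a b = 1)
    (hp : p ∈ stdSimplex ℝ A) (hp' : p' ∈ stdSimplex ℝ A)
    (hpQ : ∀ b, ∑ a, p a * Q a b = p b) (hpQ' : ∀ b, ∑ a, p' a * Q' a b = p' b)
    (hμ : ∀ a b, |Q' a b - Q a b| ≤ μ a * Q a b) (hμ0 : ∀ a, 0 ≤ μ a) (hs : ∑ a, μ a ≤ 1 / 4) :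
    ∑ b, |p' b - p b| ≤ 4 * ∑ a, μ a := by
  have hpos := pos_of_stationary hQ hp hpQ
  have hpne : ∀ b, p b ≠ 0 := fun b => (hpos b).ne'
  -- The time reversal of Q. The density r = p'/p solves (I − P) r = ∑ₐ hₐ, where hₐ comes from
  -- perturbing row a alone and is dominated by r(a) μ(a) P(·, a), exactly the form required by
  -- `abs_sub_le_of_poisson`.
  set P : A → A → ℝ := fun b a => p a * Q a b / p b with hPdef
  have hP : ∀ b c, 0 < P b c := fun b c => div_pos (mul_pos (hpos c) (hQ c b)) (hpos b)
  have hP1 : ∀ b, ∑ c, P b c = 1 := fun b => by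
    simp only [hPdef, ← Finset.sum_div, hpQ, div_self (hpne b)]
  have hpP : ∀ c, ∑ b, p b * P b c = p c := fun c => by
    simp only [hPdef, mul_div_cancel₀ _ (hpne _), ← Finset.mul_sum, hQ1, mul_one]
  set h : A → A → ℝ := fun a b => p' a * (Q' a b - Q a b) / p b with hhdef
  have hph : ∀ a, ∑ b, p b * h a b = 0 := fun a => by
    simp only [hhdef, mul_div_cancel₀ _ (hpne _), ← Finset.mul_sum, Finset.sum_sub_distrib, hQ1,
      hQ1', sub_self, mul_zero]
  choose f hf using fun a => exists_poisson_solution hP hP1 p hp.2 hpP (h a) (hph a)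
  set r : A → ℝ := fun b => p' b / p b with hr
  have hr0 : ∀ b, 0 ≤ r b := fun b => div_nonneg (hp'.1 b) (hpos b).le
  have hosc : ∀ a b, |f a b - f a a| ≤ r a * μ a := fun a =>
    abs_sub_le_of_poisson hP hP1 a (f a) (h a) _ (mul_nonneg (hr0 a) (hμ0 a)) (hf a) fun b => by
      have h1 : r a * μ a * P b a = p' a * (μ a * Q a b) / p b := by
        simp only [hr, hPdef]
        have := hpne a
        have := hpne b
        field_simp
      rw [h1, hhdef, abs_div, abs_mul, abs_of_nonneg (hp'.1 a), abs_of_pos (hpos b)]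
      exact div_le_div_of_nonneg_right (mul_le_mul_of_nonneg_left (hμ a b) (hp'.1 a)) (hpos b).le
  have hPr : ∀ b, r b - ∑ c, P b c * r c = ∑ a, h a b := fun b => by
    have h1 : ∀ c, P b c * r c = p' c * Q c b / p b := fun c => by
      simp only [hr, hPdef]
      have := hpne c
      have := hpne b
      field_simp
    simp only [h1, hhdef, mul_sub, sub_div, Finset.sum_sub_distrib, ← Finset.sum_div, hpQ']
    rfl
  -- Two solutions of the same Poisson equation differ by a constant, so the oscillation of r is at
  -- most the sum of those of the f a.
  have hconst : ∀ b c, r b - ∑ a, f a b = r c - ∑ a, f a c := fun b c => by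
    have h1 := abs_sub_le_of_poisson hP hP1 c (fun b => r b - ∑ a, f a b) 0 0 le_rfl
      (fun b => by
        have h2 : ∑ c, P b c * ∑ a, f a c = ∑ a, ∑ c, P b c * f a c := by
          simp only [Finset.mul_sum]
          exact Finset.sum_comm
        have h3 : ∑ a, f a b - ∑ a, ∑ c, P b c * f a c = ∑ a, h a b := by
          rw [← Finset.sum_sub_distrib]
          exact Finset.sum_congr rfl fun a _ => hf a b
        simp only [mul_sub, Finset.sum_sub_distrib, h2, Pi.zero_apply]
        linarith [hPr b])
      (by simp) b
    exact sub_eq_zero.1 (abs_eq_zero.1 (le_antisymm h1 (abs_nonneg _)))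
  have : Nonempty A := by
    by_contra hA
    rw [not_nonempty_iff] at hA
    simpa using hp.2
  obtain ⟨b₀, hb₀⟩ := Finite.exists_max r
  set s := ∑ a, μ a with hsdef
  have hs0 : 0 ≤ s := Finset.sum_nonneg fun a _ => hμ0 a
  have hdiff : ∀ b c, |r b - r c| ≤ 2 * r b₀ * s := fun b c => by
    have h1 : r b - r c = ∑ a, (f a b - f a c) := by
      rw [Finset.sum_sub_distrib]; linarith [hconst b c]
    rw [h1, hsdef, Finset.mul_sum]
    refine (Finset.abs_sum_le_sum_abs _ _).trans (Finset.sum_le_sum fun a _ => ?_)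
    have h2 : |f a b - f a c| ≤ |f a b - f a a| + |f a c - f a a| := by
      rw [abs_sub_comm (f a c)]; exact abs_sub_le _ _ _
    have h3 := mul_le_mul_of_nonneg_right (hb₀ a) (hμ0 a)
    linarith [hosc a b, hosc a c]
  have hmean : ∑ b, p b * r b = 1 := by
    simp only [hr, mul_div_cancel₀ _ (hpne _), hp'.2]
  have hone : ∀ b, |r b - 1| ≤ 2 * r b₀ * s := fun b => by
    have h1 : r b - 1 = ∑ c, p c * (r b - r c) := by
      simp only [mul_sub, Finset.sum_sub_distrib, ← Finset.sum_mul, hmean, hp.2, one_mul]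
    rw [h1]
    calc |∑ c, p c * (r b - r c)| ≤ ∑ c, p c * (2 * r b₀ * s) := by
          refine (Finset.abs_sum_le_sum_abs _ _).trans (Finset.sum_le_sum fun c _ => ?_)
          rw [abs_mul, abs_of_pos (hpos c)]
          exact mul_le_mul_of_nonneg_left (hdiff b c) (hpos c).le
      _ = 2 * r b₀ * s := by rw [← Finset.sum_mul, hp.2, one_mul]
  -- Self-bounding: max r ≤ 1 + 2 (max r) s with s ≤ 1/4.
  have hr2 : r b₀ ≤ 2 := by
    have := (abs_le.1 (hone b₀)).2
    nlinarith [hr0 b₀]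
  calc ∑ b, |p' b - p b| ≤ ∑ b, p b * (4 * s) := by
        refine Finset.sum_le_sum fun b _ => ?_
        have h1 : p' b - p b = p b * (r b - 1) := by
          simp only [hr, mul_sub, mul_div_cancel₀ _ (hpne b), mul_one]
        rw [h1, abs_mul, abs_of_pos (hpos b)]
        refine mul_le_mul_of_nonneg_left ((hone b).trans ?_) (hpos b).le
        nlinarith
    _ = 4 * s := by rw [← Finset.sum_mul, hp.2, one_mul]

end Stationary

end LargeGames

namespace LargeGames

/-! ### Swap regret of a single player -/

section SwapRegret

variable {A : Type*} [Fintype A]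

theorem openSimplex_subset_stdSimplex : openSimplex A ⊆ stdSimplex ℝ A :=
  fun _ hx => ⟨fun r => (hx.1 r).le, hx.2⟩

theorem sub_dotProduct_le {y z v : A → ℝ} {K : ℝ} (hy : y ∈ stdSimplex ℝ A)
    (hz : z ∈ stdSimplex ℝ A) (hv : ∀ r, |v r| ≤ K) : (y - z) ⬝ᵥ v ≤ 2 * K := by
  have h1 : y ⬝ᵥ v ≤ K := by
    calc y ⬝ᵥ v ≤ ∑ r, y r * K := Finset.sum_le_sum fun r _ =>
          mul_le_mul_of_nonneg_left ((le_abs_self _).trans (hv r)) (hy.1 r)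
      _ = K := by rw [← Finset.sum_mul, hy.2, one_mul]
  have h2 : -K ≤ z ⬝ᵥ v := by
    calc -K = ∑ r, z r * -K := by rw [← Finset.sum_mul, hz.2, one_mul]
      _ ≤ z ⬝ᵥ v := Finset.sum_le_sum fun r _ =>
          mul_le_mul_of_nonneg_left (neg_le_of_abs_le (hv r)) (hz.1 r)
  rw [sub_dotProduct]
  linarith

theorem sum_sq_le_one {y : A → ℝ} (hy : y ∈ stdSimplex ℝ A) : ∑ r, y r ^ 2 ≤ 1 := by
  rw [← hy.2]
  refine Finset.sum_le_sum fun r _ => ?_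
  have h1 : y r ≤ 1 := hy.2 ▸ Finset.single_le_sum (fun r _ => hy.1 r) (Finset.mem_univ r)
  nlinarith [hy.1 r]

/-- Weighted AM–GM in each coordinate. The weight 1/24 is chosen so that, against the Bregman term
1/6, a negative 1/8 survives. -/
theorem mul_sub_dotProduct_le {η W : ℝ} {y z v : A → ℝ} (hy : y ∈ openSimplex A)
    (hv : ∀ r, |v r| ≤ W) :
    η * ((z - y) ⬝ᵥ v) ≤ localDist z y ^ 2 / 24 + 6 * η ^ 2 * W ^ 2 := by
  rw [sum_mul_sub_eq hy.1, Finset.mul_sum, sq_localDist]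
  calc ∑ r, η * ((z r / y r - 1) * (y r * v r))
      ≤ ∑ r, ((z r / y r - 1) ^ 2 / 24 + 6 * η ^ 2 * W ^ 2 * y r ^ 2) := by
        refine Finset.sum_le_sum fun r _ => ?_
        have h1 : v r ^ 2 ≤ W ^ 2 := sq_le_sq' (neg_le_of_abs_le (hv r)) (le_of_abs_le (hv r))
        have h2 := mul_le_mul_of_nonneg_left h1 (by positivity : 0 ≤ 6 * η ^ 2 * y r ^ 2)
        nlinarith [sq_nonneg ((z r / y r - 1) - 12 * (η * y r * v r))]
    _ = (∑ r, (z r / y r - 1) ^ 2) / 24 + 6 * η ^ 2 * W ^ 2 * ∑ r, y r ^ 2 := by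
        rw [Finset.sum_add_distrib, Finset.sum_div, Finset.mul_sum]
    _ ≤ _ := by
        have := mul_le_mul_of_nonneg_left (sum_sq_le_one (openSimplex_subset_stdSimplex hy))
          (by positivity : 0 ≤ 6 * η ^ 2 * W ^ 2)
        linarith

/-- Regret of OFTRL bounded by the variation in utilities, with the local path length of the
iterates as a negative term. -/
theorem IsOFTRLLogBar.regret_le_variation {η : ℝ} {w y : ℕ → A → ℝ} (h : IsOFTRLLogBar η w y)
    {W : ℕ → ℝ} (hW : ∀ t r, |w (t + 1) r - w t r| ≤ W t)
    (hν : ∀ t, localDist (y (t + 1)) (y t) ≤ 1) (T : ℕ) {z : A → ℝ} (hz : z ∈ openSimplex A) :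
    η * ∑ t ∈ Finset.range T, (z ⬝ᵥ w (t + 1) - y (t + 1) ⬝ᵥ w (t + 1)) ≤
      logBarrier z - logBarrier (y 0) + η * ((y (T + 1) - z) ⬝ᵥ w T)
        + 6 * η ^ 2 * ∑ t ∈ Finset.range T, W t ^ 2
        - (∑ t ∈ Finset.range T, localDist (y (t + 1)) (y t) ^ 2) / 8 := by
  have hD : ∀ t, localDist (y (t + 1)) (y t) ^ 2 / 6 ≤ logBregman (y (t + 1)) (y t) := fun t =>
    sq_localDist_div_six_le_logBregman (h.mem t).1 (h.mem (t + 1)).1 (hν t)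
  have h1 : ∑ t ∈ Finset.range T, (η * ((y (t + 2) - y (t + 1)) ⬝ᵥ (w (t + 1) - w t))
          - logBregman (y (t + 2)) (y (t + 1))) ≤
      ∑ t ∈ Finset.range T, (6 * η ^ 2 * W t ^ 2
        - localDist (y (t + 2)) (y (t + 1)) ^ 2 / 8) := by
    refine Finset.sum_le_sum fun t _ => ?_
    have := mul_sub_dotProduct_le (η := η) (z := y (t + 2)) (v := w (t + 1) - w t)
      (h.mem (t + 1)) (hW t)
    linarith [hD (t + 1)]
  -- Index shift: the initial divergence supplies the step from time 0 to 1, and the surplus last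
  -- step is dropped.
  have h2 : (∑ t ∈ Finset.range T, localDist (y (t + 1)) (y t) ^ 2) / 8 ≤
      logBregman (y 1) (y 0) +
        (∑ t ∈ Finset.range T, localDist (y (t + 2)) (y (t + 1)) ^ 2) / 8 := by
    have h3 := Finset.sum_range_succ (fun t => localDist (y (t + 1)) (y t) ^ 2) T
    rw [Finset.sum_range_succ'] at h3
    have h4 := hD 0
    simp only [zero_add] at h3 h4
    have h5 := sq_nonneg (localDist (y (T + 1)) (y T))
    have h6 := sq_nonneg (localDist (y 1) (y 0))
    linarith
  have h3 := h.regret_le T hz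
  have h4 : ∑ t ∈ Finset.range T, (6 * η ^ 2 * W t ^ 2
        - localDist (y (t + 2)) (y (t + 1)) ^ 2 / 8) = 6 * η ^ 2 * ∑ t ∈ Finset.range T, W t ^ 2
        - (∑ t ∈ Finset.range T, localDist (y (t + 2)) (y (t + 1)) ^ 2) / 8 := by
    rw [Finset.sum_sub_distrib, Finset.mul_sum, Finset.sum_div]
  linarith

/-- The best response may lie on the boundary, where the barrier is infinite; mixing in a fraction s
of an interior point costs only m log(1/s). -/
theorem logBarrier_mix_le {p y : A → ℝ} (hp : p ∈ stdSimplex ℝ A) (hy : y ∈ openSimplex A)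
    {s : ℝ} (hs0 : 0 < s) (hs1 : s ≤ 1) :
    (1 - s) • p + s • y ∈ openSimplex A ∧
      logBarrier ((1 - s) • p + s • y) ≤ logBarrier y + Fintype.card A * -Real.log s := by
  have hle : ∀ r, s * y r ≤ ((1 - s) • p + s • y) r := fun r => by
    have := mul_nonneg (sub_nonneg.2 hs1) (hp.1 r)
    simpa using this
  have hpos : ∀ r, 0 < s * y r := fun r => mul_pos hs0 (hy.1 r)
  refine ⟨⟨fun r => (hpos r).trans_le (hle r), ?_⟩, ?_⟩
  · simp only [Pi.add_apply, Pi.smul_apply, smul_eq_mul, Finset.sum_add_distrib, ← Finset.mul_sum,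
      hp.2, hy.2]
    ring
  · have h1 : ∑ r, (Real.log s + Real.log (y r)) ≤
        ∑ r, Real.log (((1 - s) • p + s • y) r) := by
      refine Finset.sum_le_sum fun r _ => ?_
      rw [← Real.log_mul hs0.ne' (hy.1 r).ne']
      exact Real.log_le_log (hpos r) (hle r)
    rw [Finset.sum_add_distrib, Finset.sum_const, Finset.card_univ, nsmul_eq_mul] at h1
    simp only [logBarrier]
    linarith

/-- The iterates of OFTRL on scaled utilities `q t • u t` move slowly in the local norm. -/
theorem IsOFTRLLogBar.localDist_le {η : ℝ} (hη0 : 0 ≤ η) (hη : η ≤ 1 / 128)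
    {q : ℕ → ℝ} (hq0 : ∀ t, 0 ≤ q t) (hq1 : ∀ t, q t ≤ 1) {u y : ℕ → A → ℝ}
    (hu : ∀ t r, |u t r| ≤ 1) (h : IsOFTRLLogBar η (fun t => q t • u t) y) (t : ℕ) :
    localDist (y (t + 1)) (y t) ≤ 2 * (η * (2 * q t + q (t - 1))) := by
  have hw : ∀ t r, |q t * u t r| ≤ q t := fun t r => by
    rw [abs_mul, abs_of_nonneg (hq0 t)]
    exact mul_le_of_le_one_right (hq0 t) (hu t r)
  refine localDist_le_of_isMaxOn (h.mem t) (h.mem (t + 1)) (h.isMaxOn t)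
    (optimisticSum_succ _ t ▸ h.isMaxOn (t + 1)) (fun r => ?_) ?_
  · rw [abs_mul, abs_of_nonneg hη0]
    refine mul_le_mul_of_nonneg_left ?_ hη0
    -- At t = 0 the truncated index makes q (t - 1) equal to q 0, which is harmless slack.
    cases t with
    | zero =>
      simp only [utilityStep, Pi.smul_apply, smul_eq_mul]
      linarith [hw 0 r, hq0 0]
    | succ t =>
      simp only [utilityStep, Pi.add_apply, Pi.sub_apply, Pi.smul_apply, smul_eq_mul,
        Nat.add_sub_cancel]
      have h1 := abs_le.1 (hw (t + 1) r)
      have h2 := abs_le.1 (hw t r)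
      rw [abs_le]
      constructor <;> linarith [h1.1, h1.2, h2.1, h2.2]
  · have h1 := hq1 t
    have h2 := hq1 (t - 1)
    have h3 := hq0 t
    have h4 := hq0 (t - 1)
    nlinarith

theorem swapValue_eq_sum_rows [DecidableEq A] (φ : (A → ℝ) →ₗ[ℝ] (A → ℝ)) (x u : A → ℝ) :
    φ x ⬝ᵥ u = ∑ a, φ (Pi.single a 1) ⬝ᵥ (x a • u) := by
  have h : x = ∑ a, x a • (Pi.single a (1 : ℝ) : A → ℝ) := by
    ext b
    simp [Finset.sum_apply, Pi.single_apply]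
  conv_lhs => rw [h]
  simp only [map_sum, map_smul, sum_dotProduct, smul_dotProduct, dotProduct_smul]

theorem sq_sum_abs_stationary_sub_le {Q Q' : A → A → ℝ} {p p' : A → ℝ}
    (hQ : ∀ a, Q a ∈ openSimplex A) (hQ' : ∀ a, Q' a ∈ openSimplex A)
    (hp : p ∈ stdSimplex ℝ A) (hp' : p' ∈ stdSimplex ℝ A)
    (hpQ : ∀ b, ∑ a, p a * Q a b = p b) (hpQ' : ∀ b, ∑ a, p' a * Q' a b = p' b)
    (hs : ∑ a, localDist (Q' a) (Q a) ≤ 1 / 4) :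
    (∑ b, |p' b - p b|) ^ 2 ≤
      16 * Fintype.card A * ∑ a, localDist (Q' a) (Q a) ^ 2 := by
  have h1 := sum_abs_stationary_sub_le (fun a => (hQ a).1) (fun a => (hQ a).2)
    (fun a => (hQ' a).2) hp hp' hpQ hpQ' (μ := fun a => localDist (Q' a) (Q a))
    (fun a b => by
      have h2 : Q' a b - Q a b = (Q' a b / Q a b - 1) * Q a b := by
        have := ((hQ a).1 b).ne'
        field_simp
      rw [h2, abs_mul, abs_of_pos ((hQ a).1 b)]
      exact mul_le_mul_of_nonneg_right (abs_div_sub_one_le_localDist _ _ b) ((hQ a).1 b).le)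
    (fun a => localDist_nonneg _ _) hs
  have h3 := sq_sum_le_card_mul_sum_sq (s := Finset.univ) (f := fun a => localDist (Q' a) (Q a))
  rw [Finset.card_univ] at h3
  have h4 := pow_le_pow_left₀ (Finset.sum_nonneg fun b _ => abs_nonneg _) h1 2
  nlinarith

/-- Swap regret of BM-OFTRL-LogBar bounded by the variation in utilities, with the path length
of the strategies as a negative term. -/
theorem IsBMOFTRLLogBar.swapRegret_le [Nonempty A] {η : ℝ} (hη0 : 0 < η)
    (hη : η ≤ 1 / (128 * √(Fintype.card A : ℝ))) {u x : ℕ → A → ℝ} (h : IsBMOFTRLLogBar η u x)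
    (hu : ∀ t r, |u t r| ≤ 1) {d : ℕ → ℝ} (hd : ∀ t r, |u (t + 1) r - u t r| ≤ d t)
    {T : ℕ} (hT : 2 ≤ T) :
    swapRegret T u x ≤ 2 * (Fintype.card A : ℝ) ^ 2 * Real.log T / η
      + 16 * η * ∑ t ∈ Finset.range T, d t ^ 2
      - 1 / (512 * η * Fintype.card A) *
        ∑ t ∈ Finset.range T, (∑ a, |x (t + 1) a - x t a|) ^ 2 := by
  classical
  obtain ⟨Q, hQ, hx⟩ := h
  set m : ℝ := (Fintype.card A : ℝ) with hm
  have hm1 : 1 ≤ m := Nat.one_le_cast.2 Fintype.card_pos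
  have hη1 : η ≤ 1 / 128 := hη.trans <| one_div_le_one_div_of_le (by norm_num) <| by
    linarith [Real.one_le_sqrt.2 hm1]
  have hηm : 16384 * η ^ 2 * m ≤ 1 := by
    rw [le_div_iff₀ (by positivity)] at hη
    have := pow_le_pow_left₀ (by positivity) hη 2
    rw [mul_pow, mul_pow, Real.sq_sqrt (by positivity)] at this
    linarith
  have hx0 : ∀ t a, 0 ≤ x t a := fun t a => (hx t).1.1 a
  have hx1 : ∀ t a, x t a ≤ 1 := fun t a =>
    (hx t).1.2 ▸ Finset.single_le_sum (fun r _ => hx0 t r) (Finset.mem_univ a)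
  have hxQ : ∀ t b, ∑ a, x t a * Q t a b = x t b := fun t b => by
    have := congrFun (hx t).2 b
    simp only [Matrix.mulVec, dotProduct, Matrix.transpose_apply] at this
    rw [← this]
    exact Finset.sum_congr rfl fun a _ => mul_comm _ _
  set ν : ℕ → A → ℝ := fun t a => localDist (Q (t + 1) a) (Q t a) with hνdef
  have hν : ∀ t a, ν t a ≤ 2 * (η * (2 * x t a + x (t - 1) a)) := fun t a =>
    (hQ a).localDist_le hη0.le hη1 (fun t => hx0 t a) (fun t => hx1 t a) hu t
  have hν1 : ∀ t a, ν t a ≤ 1 := fun t a => by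
    have := hν t a
    nlinarith [hx0 t a, hx1 t a, hx0 (t - 1) a, hx1 (t - 1) a]
  -- Row a sees utilities scaled by x t a, and these weights sum to 1, so the total is at most 6η,
  -- free of a factor m.
  have hνs : ∀ t, ∑ a, ν t a ≤ 1 / 4 := fun t => by
    have := Finset.sum_le_sum fun a (_ : a ∈ Finset.univ) => hν t a
    simp only [← Finset.mul_sum, Finset.sum_add_distrib, (hx t).1.2, (hx (t - 1)).1.2] at this
    linarith
  set X : ℕ → ℝ := fun t => ∑ a, |x (t + 1) a - x t a| with hXdef
  have hX : ∀ t, X t ^ 2 ≤ 16 * m * ∑ a, ν t a ^ 2 := fun t =>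
    sq_sum_abs_stationary_sub_le (fun a => (hQ a).mem t) (fun a => (hQ a).mem (t + 1))
      (hx t).1 (hx (t + 1)).1 (hxQ t) (hxQ (t + 1)) (hνs t)
  have hT0 : (0 : ℝ) < T := by positivity
  have hT1 : (1 : ℝ) ≤ T := by exact_mod_cast (by omega : 1 ≤ T)
  have hlog : 1 / 2 ≤ Real.log T := by
    have h1 : (2 : ℝ) ≤ T := by exact_mod_cast hT
    linarith [Real.log_two_gt_d9, Real.log_le_log (by norm_num) h1]
  suffices hmain : ∀ φ : (A → ℝ) →ₗ[ℝ] (A → ℝ),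
      Set.MapsTo φ (stdSimplex ℝ A) (stdSimplex ℝ A) →
      η * (∑ t ∈ Finset.Icc 1 T, φ (x t) ⬝ᵥ u t - ∑ t ∈ Finset.Icc 1 T, x t ⬝ᵥ u t) ≤
        2 * m ^ 2 * Real.log T + 16 * η ^ 2 * ∑ t ∈ Finset.range T, d t ^ 2
          - 1 / (512 * m) * ∑ t ∈ Finset.range T, X t ^ 2 by
    obtain ⟨φ, hφ, hφv⟩ := (isGreatest_sSup_swapValues T u x).1
    have h1 := hmain φ hφ
    rw [← hφv] at h1
    change η * swapRegret T u x ≤ _ at h1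
    rw [mul_comm, ← le_div_iff₀ hη0] at h1
    refine h1.trans_eq ?_
    simp only [hXdef]
    field_simp
  intro φ hφ
  -- Mixing at rate 1/T costs at most 2η in total over T rounds (after scaling by η), and makes the
  -- barrier cost m log T per row.
  set s : ℝ := 1 / T with hs
  have hs0 : 0 < s := by positivity
  have hs1 : s ≤ 1 := by rw [hs, div_le_one hT0]; exact hT1
  set p : A → A → ℝ := fun a => φ (Pi.single a 1) with hpdef
  have hp : ∀ a, p a ∈ stdSimplex ℝ A := fun a => hφ (single_mem_stdSimplex ℝ a)
  set z : A → A → ℝ := fun a => (1 - s) • p a + s • Q 0 a with hzdef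
  have hz := fun a => logBarrier_mix_le (hp a) ((hQ a).mem 0) hs0 hs1
  have hw : ∀ t a r, |(x t a • u t) r| ≤ x t a := fun t a r => by
    rw [Pi.smul_apply, smul_eq_mul, abs_mul, abs_of_nonneg (hx0 t a)]
    exact mul_le_of_le_one_right (hx0 t a) (hu t r)
  set W : ℕ → A → ℝ := fun t a => x (t + 1) a * d t + |x (t + 1) a - x t a| with hWdef
  have hW : ∀ a t r, |(x (t + 1) a • u (t + 1)) r - (x t a • u t) r| ≤ W t a := fun a t r => by
    have h1 : (x (t + 1) a • u (t + 1)) r - (x t a • u t) r =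
        x (t + 1) a * (u (t + 1) r - u t r) + (x (t + 1) a - x t a) * u t r := by
      simp only [Pi.smul_apply, smul_eq_mul]; ring
    rw [h1]
    refine (abs_add_le _ _).trans (add_le_add ?_ ?_)
    · rw [abs_mul, abs_of_nonneg (hx0 _ a)]
      exact mul_le_mul_of_nonneg_left (hd t r) (hx0 _ a)
    · rw [abs_mul]
      exact mul_le_of_le_one_right (abs_nonneg _) (hu t r)
  have hWs : ∀ t, ∑ a, W t a ^ 2 ≤ 2 * d t ^ 2 + 2 * X t ^ 2 := fun t => by
    have h1 : ∑ a, |x (t + 1) a - x t a| ^ 2 ≤ X t ^ 2 :=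
      Finset.sum_sq_le_sq_sum_of_nonneg fun a _ => abs_nonneg _
    have h2 := mul_le_mul_of_nonneg_right (sum_sq_le_one (hx (t + 1)).1) (sq_nonneg (d t))
    have h3 : ∑ a, W t a ^ 2 ≤
        ∑ a, (2 * (x (t + 1) a ^ 2 * d t ^ 2) + 2 * |x (t + 1) a - x t a| ^ 2) :=
      Finset.sum_le_sum fun a _ => by
        nlinarith [sq_nonneg (x (t + 1) a * d t - |x (t + 1) a - x t a|)]
    rw [Finset.sum_add_distrib, ← Finset.mul_sum, ← Finset.mul_sum, ← Finset.sum_mul] at h3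
    linarith
  have hrow : ∀ a, η * ∑ t ∈ Finset.range T, (p a ⬝ᵥ (x (t + 1) a • u (t + 1))
        - Q (t + 1) a ⬝ᵥ (x (t + 1) a • u (t + 1))) ≤
      m * Real.log T + η * (2 * x T a) + η * ∑ t ∈ Finset.range T, s * (2 * x (t + 1) a)
        + 6 * η ^ 2 * ∑ t ∈ Finset.range T, W t a ^ 2
        - (∑ t ∈ Finset.range T, ν t a ^ 2) / 8 := fun a => by
    have h1 := (hQ a).regret_le_variation (hW a) (fun t => hν1 t a) T (hz a).1
    have h2 := (hz a).2
    have h3 : -Real.log s = Real.log T := by rw [hs, one_div, Real.log_inv, neg_neg]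
    rw [h3] at h2
    have h4 := mul_le_mul_of_nonneg_left (sub_dotProduct_le
      (openSimplex_subset_stdSimplex ((hQ a).mem (T + 1)))
      (openSimplex_subset_stdSimplex (hz a).1) (hw T a)) hη0.le
    have h5 : ∑ t ∈ Finset.range T, (p a ⬝ᵥ (x (t + 1) a • u (t + 1))
        - Q (t + 1) a ⬝ᵥ (x (t + 1) a • u (t + 1))) ≤
        ∑ t ∈ Finset.range T, (z a ⬝ᵥ (x (t + 1) a • u (t + 1))
        - Q (t + 1) a ⬝ᵥ (x (t + 1) a • u (t + 1)))
        + ∑ t ∈ Finset.range T, s * (2 * x (t + 1) a) := by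
      rw [← Finset.sum_add_distrib]
      refine Finset.sum_le_sum fun t _ => ?_
      have h6 := mul_le_mul_of_nonneg_left (sub_dotProduct_le (hp a)
        (openSimplex_subset_stdSimplex ((hQ a).mem 0)) (hw (t + 1) a)) hs0.le
      simp only [hzdef, add_dotProduct, sub_dotProduct, smul_dotProduct, smul_eq_mul] at h6 ⊢
      linarith
    have h7 := mul_le_mul_of_nonneg_left h5 hη0.le
    rw [mul_add] at h7
    linarith
  have hsum := Finset.sum_le_sum fun a (_ : a ∈ Finset.univ) => hrow a
  have hL : ∑ a, η * ∑ t ∈ Finset.range T, (p a ⬝ᵥ (x (t + 1) a • u (t + 1))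
        - Q (t + 1) a ⬝ᵥ (x (t + 1) a • u (t + 1))) =
      η * (∑ t ∈ Finset.Icc 1 T, φ (x t) ⬝ᵥ u t - ∑ t ∈ Finset.Icc 1 T, x t ⬝ᵥ u t) := by
    rw [← Finset.mul_sum, Finset.sum_comm, sum_Icc_one_eq_sum_range, sum_Icc_one_eq_sum_range,
      ← Finset.sum_sub_distrib]
    congr 1
    refine Finset.sum_congr rfl fun t _ => ?_
    rw [Finset.sum_sub_distrib, swapValue_eq_sum_rows φ]
    congr 1
    simp only [dotProduct_smul, smul_eq_mul]
    -- Stationarity is what turns the sum of row regrets into swap regret.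
    have h1 : x (t + 1) = ∑ a, x (t + 1) a • Q (t + 1) a := by
      ext b
      simp only [Finset.sum_apply, Pi.smul_apply, smul_eq_mul, hxQ]
    conv_rhs => rw [h1]
    simp only [sum_dotProduct, smul_dotProduct, smul_eq_mul]
  have hs2 : ∑ a, ∑ t ∈ Finset.range T, s * (2 * x (t + 1) a) = 2 := by
    rw [Finset.sum_comm]
    simp only [← Finset.mul_sum, (hx _).1.2]
    rw [Finset.sum_const, Finset.card_range, nsmul_eq_mul, hs]
    field_simp
  have hs3 : ∑ a, ∑ t ∈ Finset.range T, W t a ^ 2 ≤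
      2 * ∑ t ∈ Finset.range T, d t ^ 2 + 2 * ∑ t ∈ Finset.range T, X t ^ 2 := by
    rw [Finset.sum_comm, Finset.mul_sum, Finset.mul_sum, ← Finset.sum_add_distrib]
    exact Finset.sum_le_sum fun t _ => hWs t
  have hs4 : ∑ t ∈ Finset.range T, X t ^ 2 ≤
      16 * m * ∑ a, ∑ t ∈ Finset.range T, ν t a ^ 2 := by
    rw [Finset.sum_comm, Finset.mul_sum]
    exact Finset.sum_le_sum fun t _ => hX t
  rw [hL] at hsum
  simp only [Finset.sum_add_distrib, Finset.sum_sub_distrib, ← Finset.mul_sum, ← Finset.sum_div,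
    Finset.sum_const, Finset.card_univ, nsmul_eq_mul, (hx _).1.2] at hsum hs2
  rw [← hm] at hsum
  rw [hs2] at hsum
  have hX0 : 0 ≤ ∑ t ∈ Finset.range T, X t ^ 2 := Finset.sum_nonneg fun t _ => sq_nonneg _
  have hD0 : 0 ≤ ∑ t ∈ Finset.range T, d t ^ 2 := Finset.sum_nonneg fun t _ => sq_nonneg _
  generalize ∑ t ∈ Finset.range T, X t ^ 2 = S at *
  generalize ∑ t ∈ Finset.range T, d t ^ 2 = D at *
  generalize ∑ a, ∑ t ∈ Finset.range T, ν t a ^ 2 = N at *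
  have hm0 : 0 < m := by linarith
  have h1 : 1 / (512 * m) * S = S / m / 512 := by field_simp
  have h2 : S / m ≤ 16 * N := by
    rw [div_le_iff₀ hm0]; linarith
  -- The 12η²S created by the players' own movement is thus negligible against N/8 ≥ S/(128m); the
  -- leftover 4η is absorbed into the second copy of m² log T.
  have h3 : 16384 * (η ^ 2 * S) ≤ S / m := by
    rw [le_div_iff₀ hm0]
    nlinarith [mul_le_mul_of_nonneg_right hηm hX0]
  have h4 : 1 / 2 ≤ m ^ 2 * Real.log T := by nlinarith
  have h5 := mul_le_mul_of_nonneg_left hs3 (by positivity : 0 ≤ 6 * η ^ 2)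
  have h6 : 0 ≤ S / m := div_nonneg hX0 hm0.le
  have h7 : 0 ≤ η ^ 2 * D := mul_nonneg (sq_nonneg _) hD0
  rw [h1]
  linarith

end SwapRegret

end LargeGames

namespace LargeGames

theorem swapRegret_nonneg {A : Type*} [Fintype A] [Nonempty A] (T : ℕ) (u x : ℕ → A → ℝ) :
    0 ≤ swapRegret T u x :=
  sub_nonneg.2 <| (isGreatest_sSup_swapValues T u x).2
    ⟨LinearMap.id, fun _ h => h, by simp⟩

/-! ### Lipschitz dependence of expected utilities on mixed strategies -/

section ProductExpectation

variable {ι : Type*} [Fintype ι] [DecidableEq ι] {B : ι → Type*} [∀ j, Fintype (B j)]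

/-- The expectation of `g` under the product of the distributions `x j`. -/
def productExpectation (g : (∀ j, B j) → ℝ) (x : ∀ j, B j → ℝ) : ℝ :=
  ∑ b, (∏ j, x j (b j)) * g b

theorem abs_productExpectation_le {g : (∀ j, B j) → ℝ} (hg : ∀ b, |g b| ≤ 1) {x : ∀ j, B j → ℝ}
    (hx : ∀ j, x j ∈ stdSimplex ℝ (B j)) : |productExpectation g x| ≤ 1 := by
  have h0 : ∀ b : ∀ j, B j, 0 ≤ ∏ j, x j (b j) := fun b =>
    Finset.prod_nonneg fun j _ => (hx j).1 _
  calc |productExpectation g x| ≤ ∑ b : ∀ j, B j, ∏ j, x j (b j) := by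
        refine (Finset.abs_sum_le_sum_abs _ _).trans (Finset.sum_le_sum fun b _ => ?_)
        rw [abs_mul, abs_of_nonneg (h0 b)]
        exact mul_le_of_le_one_right (h0 b) (hg b)
    _ = 1 := by
        rw [← Fintype.prod_sum]
        simp only [(hx _).2, Finset.prod_const_one]

theorem productExpectation_eq_sum (g : (∀ j, B j) → ℝ) (x : ∀ j, B j → ℝ) (k : ι) :
    productExpectation g x = ∑ c, x k c *
      productExpectation (fun b => g ((Equiv.piSplitAt k B).symm (c, b)))
        (fun j : {j // j ≠ k} => x j) := by
  rw [productExpectation, ← (Equiv.piSplitAt k B).symm.sum_comp, Fintype.sum_prod_type]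
  refine Finset.sum_congr rfl fun c _ => ?_
  rw [productExpectation, Finset.mul_sum]
  refine Finset.sum_congr rfl fun b _ => ?_
  rw [Fintype.prod_eq_mul_prod_subtype_ne
    (fun j => x j ((Equiv.piSplitAt k B).symm (c, b) j)) k, mul_assoc]
  congr 2
  · simp [Equiv.piSplitAt]
  · refine Finset.prod_congr rfl fun j _ => ?_
    simp [Equiv.piSplitAt, j.2]

/-- The expectation is linear in the k-th distribution, with coefficients H bounded by 1. If g
ignores coordinate k, then H is constant and the increment, of total mass zero, contributes nothing.
-/
theorem abs_productExpectation_update_sub_le {g : (∀ j, B j) → ℝ} (hg : ∀ b, |g b| ≤ 1)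
    {S : Finset ι} (hS : DependsOn g (S : Set ι)) {x : ∀ j, B j → ℝ}
    (hx : ∀ j, x j ∈ stdSimplex ℝ (B j)) (k : ι) {q : B k → ℝ} (hq : q ∈ stdSimplex ℝ (B k)) :
    |productExpectation g (Function.update x k q) - productExpectation g x| ≤
      if k ∈ S then ∑ r, |q r - x k r| else 0 := by
  set H : B k → ℝ := fun c =>
    productExpectation (fun b => g ((Equiv.piSplitAt k B).symm (c, b)))
      (fun j : {j // j ≠ k} => x j) with hH
  have h1 : productExpectation g (Function.update x k q) = ∑ c, q c * H c := by
    rw [productExpectation_eq_sum g _ k]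
    refine Finset.sum_congr rfl fun c _ => ?_
    have h2 : (fun j : {j // j ≠ k} => Function.update x k q j) =
        fun j : {j // j ≠ k} => x j :=
      funext fun j => Function.update_of_ne j.2 _ _
    rw [Function.update_self, h2]
  have h3 : productExpectation g (Function.update x k q) - productExpectation g x =
      ∑ c, (q c - x k c) * H c := by
    rw [h1, productExpectation_eq_sum g x k, ← Finset.sum_sub_distrib]
    exact Finset.sum_congr rfl fun c _ => by rw [sub_mul]
  rw [h3]
  split_ifs with hk
  · refine (Finset.abs_sum_le_sum_abs _ _).trans (Finset.sum_le_sum fun c _ => ?_)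
    rw [abs_mul]
    exact mul_le_of_le_one_right (abs_nonneg _)
      (abs_productExpectation_le (fun b => hg _) fun j => hx j)
  · have hconst : ∀ c c', H c = H c' := fun c c' => by
      simp only [hH]
      congr 1
      funext b
      refine hS fun j hj => ?_
      have hjk : j ≠ k := fun h => hk (h ▸ hj)
      simp [Equiv.piSplitAt, hjk]
    refine (abs_eq_zero.2 ?_).le
    rcases isEmpty_or_nonempty (B k) with hB | ⟨⟨c₀⟩⟩
    · simp
    · simp only [hconst _ c₀, ← Finset.sum_mul, Finset.sum_sub_distrib, hq.2, (hx k).2, sub_self,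
        zero_mul]

/-- The expectation of a bounded function of the coordinates in `S` is Lipschitz in the
distributions of these coordinates. -/
theorem abs_productExpectation_sub_le {g : (∀ j, B j) → ℝ} (hg : ∀ b, |g b| ≤ 1)
    {S : Finset ι} (hS : DependsOn g (S : Set ι)) {x x' : ∀ j, B j → ℝ}
    (hx : ∀ j, x j ∈ stdSimplex ℝ (B j)) (hx' : ∀ j, x' j ∈ stdSimplex ℝ (B j)) :
    |productExpectation g x' - productExpectation g x| ≤ ∑ j ∈ S, ∑ r, |x' j r - x j r| := by
  -- Hybrid argument: the distributions in F are switched one at a time.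
  have key : ∀ F : Finset ι,
      |productExpectation g (F.piecewise x' x) - productExpectation g x| ≤
        ∑ j ∈ F, if j ∈ S then ∑ r, |x' j r - x j r| else 0 := by
    intro F
    induction F using Finset.induction_on with
    | empty => simp
    | insert k F hk ih =>
      have hy : ∀ j, F.piecewise x' x j ∈ stdSimplex ℝ (B j) := fun j => by
        by_cases h : j ∈ F <;> simp [h, hx, hx']
      have h1 := abs_productExpectation_update_sub_le hg hS hy k (hx' k)
      rw [Finset.piecewise_eq_of_notMem F x' x hk] at h1
      rw [Finset.piecewise_insert, Finset.sum_insert hk]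
      exact (abs_sub_le _ _ _).trans (add_le_add h1 ih)
  have h := key Finset.univ
  rw [Finset.piecewise_univ] at h
  simpa [Finset.sum_ite_mem] using h

end ProductExpectation

/-! ### From one player to the whole game -/

section Games

variable {n : ℕ} {A : Fin n → Type*} [∀ i, Fintype (A i)]

theorem abs_utilityVector_le {u : Fin n → (∀ j, A j) → ℝ} (hu : ∀ i a, |u i a| ≤ 1)
    {x : ∀ j, A j → ℝ} (hx : ∀ j, x j ∈ stdSimplex ℝ (A j)) (i : Fin n) (a : A i) :
    |utilityVector u x i a| ≤ 1 :=
  abs_productExpectation_le (fun b => hu i ((Equiv.piSplitAt i A).symm (a, b)))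
    (fun j : {j // j ≠ i} => hx j)

/-- The utility vector of a player is Lipschitz in the strategies of the players that affect
the utility. -/
theorem abs_utilityVector_sub_le {u : Fin n → (∀ j, A j) → ℝ} (hu : ∀ i a, |u i a| ≤ 1)
    {N : Fin n → Finset (Fin n)} (hN : ∀ i, DependsOn (u i) (insert i (N i : Set (Fin n))))
    {x x' : ∀ j, A j → ℝ} (hx : ∀ j, x j ∈ stdSimplex ℝ (A j))
    (hx' : ∀ j, x' j ∈ stdSimplex ℝ (A j)) (i : Fin n) (a : A i) :
    |utilityVector u x' i a - utilityVector u x i a| ≤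
      ∑ j ∈ (N i).filter (· ≠ i), ∑ r, |x' j r - x j r| := by
  have hS : DependsOn (fun b => u i ((Equiv.piSplitAt i A).symm (a, b)))
      (((N i).subtype (· ≠ i) : Finset {j // j ≠ i}) : Set {j // j ≠ i}) := by
    intro b b' hb
    refine hN i fun j hj => ?_
    by_cases hji : j = i
    · subst hji; simp [Equiv.piSplitAt]
    · have hjN : j ∈ N i := by simpa [hji] using hj
      simpa [Equiv.piSplitAt, hji] using hb ⟨j, hji⟩ (by simpa using hjN)
  have h := abs_productExpectation_sub_le
    (fun b => hu i ((Equiv.piSplitAt i A).symm (a, b))) hS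
    (x := fun j : {j // j ≠ i} => x j) (x' := fun j : {j // j ≠ i} => x' j)
    (fun j => hx j) (fun j => hx' j)
  rwa [Finset.sum_subtype_eq_sum_filter (f := fun j => ∑ r, |x' j r - x j r|)] at h

theorem sqrt_card_le_maxSqrtActions (i : Fin n) :
    √(Fintype.card (A i) : ℝ) ≤ maxSqrtActions A :=
  le_ciSup (f := fun j => √(Fintype.card (A j) : ℝ)) (Set.finite_range _).bddAbove i

/-- The squared path length of a sequence of strategies up to time `T`. -/
def pathLength {B : Type*} [Fintype B] (T : ℕ) (x : ℕ → B → ℝ) : ℝ :=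
  ∑ t ∈ Finset.range T, (∑ r, |x (t + 1) r - x t r|) ^ 2

theorem pathLength_nonneg {B : Type*} [Fintype B] (T : ℕ) (x : ℕ → B → ℝ) :
    0 ≤ pathLength T x :=
  Finset.sum_nonneg fun _ _ => sq_nonneg _

variable [∀ i, Nonempty (A i)]

/-- The single-player bound with d_t the total movement of the neighbours; Cauchy–Schwarz over at
most c of them produces the factor c. -/
theorem AllPlayersUseBMOFTRLLogBar.playerSwapRegret_le {η : ℝ} (hη0 : 0 < η)
    (hη : η ≤ 1 / (128 * maxSqrtActions A)) {u : Fin n → (∀ j, A j) → ℝ}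
    (hu : ∀ i a, |u i a| ≤ 1) {N : Fin n → Finset (Fin n)}
    (hN : ∀ i, DependsOn (u i) (insert i (N i : Set (Fin n)))) {c : ℕ}
    (hN₁ : ∀ i, (N i).card ≤ c) {x : ∀ i, ℕ → A i → ℝ}
    (h : AllPlayersUseBMOFTRLLogBar η u x) {T : ℕ} (hT : 2 ≤ T) (i : Fin n) :
    playerSwapRegret T u x i ≤ 2 * (Fintype.card (A i) : ℝ) ^ 2 * Real.log T / η
      + 16 * η * (c * ∑ j ∈ (N i).filter (· ≠ i), pathLength T (x j))
      - 1 / (512 * η * maxSqrtActions A ^ 2) * pathLength T (x i) := by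
  have hx : ∀ j t, x j t ∈ stdSimplex ℝ (A j) := fun j t => by
    obtain ⟨Q, _, hQ⟩ := h j
    exact (hQ t).1
  have hm : (0 : ℝ) < Fintype.card (A i) := Nat.cast_pos.2 Fintype.card_pos
  have hsm : 0 < √(Fintype.card (A i) : ℝ) := Real.sqrt_pos.2 hm
  have hM := sqrt_card_le_maxSqrtActions (A := A) i
  have hηi : η ≤ 1 / (128 * √(Fintype.card (A i) : ℝ)) :=
    hη.trans (one_div_le_one_div_of_le (by positivity) (by linarith))
  have h1 := (h i).swapRegret_le hη0 hηi
    (fun t r => abs_utilityVector_le hu (fun j => hx j t) i r)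
    (fun t r => abs_utilityVector_sub_le hu hN (fun j => hx j t) (fun j => hx j (t + 1)) i r) hT
  refine h1.trans (sub_le_sub (add_le_add le_rfl (mul_le_mul_of_nonneg_left ?_ (by positivity)))
    (mul_le_mul_of_nonneg_right ?_ (pathLength_nonneg T (x i))))
  · simp only [pathLength]
    rw [Finset.sum_comm, Finset.mul_sum]
    refine Finset.sum_le_sum fun t _ => sq_sum_le_card_mul_sum_sq.trans ?_
    refine mul_le_mul_of_nonneg_right ?_ (Finset.sum_nonneg fun _ _ => sq_nonneg _)
    exact_mod_cast (Finset.card_filter_le _ _).trans (hN₁ i)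
  · refine one_div_le_one_div_of_le (by positivity) ?_
    refine mul_le_mul_of_nonneg_left ?_ (by positivity)
    have := pow_le_pow_left₀ hsm.le hM 2
    rwa [Real.sq_sqrt hm.le] at this

/-- Double counting: each j influences at most c other players. -/
theorem sum_sum_neighbors_le {N : Fin n → Finset (Fin n)} {c : ℕ}
    (hN₂ : ∀ i, (Finset.univ.filter fun j => j ≠ i ∧ i ∈ N j).card ≤ c) {f : Fin n → ℝ}
    (hf : ∀ j, 0 ≤ f j) : ∑ i, ∑ j ∈ (N i).filter (· ≠ i), f j ≤ c * ∑ j, f j := by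
  have h1 : ∀ i, ∑ j ∈ (N i).filter (· ≠ i), f j = ∑ j, if i ≠ j ∧ j ∈ N i then f j else 0 :=
    fun i => by
      rw [← Finset.sum_filter]
      refine Finset.sum_congr ?_ fun _ _ => rfl
      ext j
      simp [and_comm, eq_comm]
  simp only [h1]
  rw [Finset.sum_comm, Finset.mul_sum]
  refine Finset.sum_le_sum fun j _ => ?_
  rw [← Finset.sum_filter, Finset.sum_const, nsmul_eq_mul]
  exact mul_le_mul_of_nonneg_right (Nat.cast_le.2 (hN₂ j)) (hf j)

/-- Bounds on the swap regrets when all players use the learning rate `1 / (128 κ max_j √m_j)`,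
where `κ` is at least the degree `c` of the interactions. -/
theorem AllPlayersUseBMOFTRLLogBar.regret_bounds {κ : ℝ} {u : Fin n → (∀ j, A j) → ℝ}
    (hu : ∀ i a, |u i a| ≤ 1) {N : Fin n → Finset (Fin n)}
    (hN : ∀ i, DependsOn (u i) (insert i (N i : Set (Fin n)))) {c : ℕ} (hc : 1 ≤ c)
    (hκ : (c : ℝ) ≤ κ) (hN₁ : ∀ i, (N i).card ≤ c)
    (hN₂ : ∀ i, (Finset.univ.filter fun j => j ≠ i ∧ i ∈ N j).card ≤ c)
    {x : ∀ i, ℕ → A i → ℝ} (hM : 0 < maxSqrtActions A)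
    (h : AllPlayersUseBMOFTRLLogBar (1 / (128 * κ * maxSqrtActions A)) u x) {T : ℕ}
    (hT : 2 ≤ T) :
    (∑ i, playerSwapRegret T u x i ≤
        256 * κ * maxSqrtActions A * (∑ j, (Fintype.card (A j) : ℝ) ^ 2) * Real.log T) ∧
      ∀ i, playerSwapRegret T u x i ≤ 256 * maxSqrtActions A *
        (κ * (Fintype.card (A i) : ℝ) ^ 2 + c / κ * ∑ j, (Fintype.card (A j) : ℝ) ^ 2) *
          Real.log T := by
  have hc1 : (1 : ℝ) ≤ c := by exact_mod_cast hc
  have hκ0 : 0 < κ := by linarith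
  have hplayer := h.playerSwapRegret_le (by positivity)
    (one_div_le_one_div_of_le (by positivity) (by nlinarith)) hu hN hN₁ hT
  have hnonneg : 0 ≤ ∑ i, playerSwapRegret T u x i :=
    Finset.sum_nonneg fun i _ => swapRegret_nonneg T _ _
  set M := maxSqrtActions A
  set P := ∑ j, pathLength T (x j) with hP
  set S := ∑ j, (Fintype.card (A j) : ℝ) ^ 2 with hS
  have hP0 : 0 ≤ P := Finset.sum_nonneg fun j _ => pathLength_nonneg T (x j)
  have hsum := Finset.sum_le_sum fun i (_ : i ∈ Finset.univ) => hplayer i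
  simp only [Finset.sum_add_distrib, Finset.sum_sub_distrib, ← Finset.mul_sum, ← Finset.sum_mul,
    ← Finset.sum_div] at hsum
  rw [← hP, ← hS] at hsum
  have hnb := sum_sum_neighbors_le hN₂ fun j => pathLength_nonneg T (x j)
  rw [← hP] at hnb
  have hcoef : 16 * (1 / (128 * κ * M)) * (c * (c * P)) ≤ κ / (8 * M) * P := by
    have h1 : (c : ℝ) * c ≤ κ * κ := mul_self_le_mul_self (by linarith) hκ
    have h2 : 16 * (1 / (128 * κ * M)) * (c * (c * P)) = P / (8 * κ * M) * (c * c) := by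
      field_simp; ring
    have h3 : κ / (8 * M) * P = P / (8 * κ * M) * (κ * κ) := by field_simp
    rw [h2, h3]
    exact mul_le_mul_of_nonneg_left h1 (by positivity)
  have hneg : 1 / (512 * (1 / (128 * κ * M)) * M ^ 2) * P = 2 * (κ / (8 * M) * P) := by
    field_simp; ring
  have hmain : 2 * S * Real.log T / (1 / (128 * κ * M)) = 256 * κ * M * S * Real.log T := by
    field_simp; ring
  have hnb2 := mul_le_mul_of_nonneg_left (mul_le_mul_of_nonneg_left hnb (by linarith : (0 : ℝ) ≤ c))
    (by positivity : 0 ≤ 16 * (1 / (128 * κ * M)))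
  have hle : ∑ i, playerSwapRegret T u x i ≤
      256 * κ * M * S * Real.log T - κ / (8 * M) * P := by
    rw [hneg, hmain] at hsum
    linarith
  have hpos : 0 ≤ κ / (8 * M) * P := by positivity
  refine ⟨by linarith, fun i => (hplayer i).trans ?_⟩
  -- Nonnegativity of the total regret forces the subtracted multiple of P below the main term.
  have hPle : P ≤ 2048 * M ^ 2 * S * Real.log T := by
    have h1 : κ / (8 * M) * P ≤ κ / (8 * M) * (2048 * M ^ 2 * S * Real.log T) := by
      have h2 : κ / (8 * M) * (2048 * M ^ 2 * S * Real.log T) =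
          256 * κ * M * S * Real.log T := by field_simp; ring
      rw [h2]
      linarith
    exact le_of_mul_le_mul_left h1 (by positivity)
  have hsub : ∑ j ∈ (N i).filter (· ≠ i), pathLength T (x j) ≤ 2048 * M ^ 2 * S * Real.log T :=
    (Finset.sum_le_sum_of_subset_of_nonneg (Finset.subset_univ _)
      fun j _ _ => pathLength_nonneg T (x j)).trans hPle
  have hfin := mul_le_mul_of_nonneg_left (mul_le_mul_of_nonneg_left hsub
    (by linarith : (0 : ℝ) ≤ c)) (by positivity : 0 ≤ 16 * (1 / (128 * κ * M)))
  have hpi : 0 ≤ 1 / (512 * (1 / (128 * κ * M)) * M ^ 2) * pathLength T (x i) :=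
    mul_nonneg (by positivity) (pathLength_nonneg T (x i))
  have hfe : 2 * (Fintype.card (A i) : ℝ) ^ 2 * Real.log T / (1 / (128 * κ * M)) +
      16 * (1 / (128 * κ * M)) * (c * (2048 * M ^ 2 * S * Real.log T)) =
      256 * M * (κ * (Fintype.card (A i) : ℝ) ^ 2 + c / κ * S) * Real.log T := by
    field_simp; ring
  linarith

end Games

end LargeGames

open LargeGames
theorem mainTheorem8 {n : ℕ} {A : Fin n → Type*} [∀ i, Fintype (A i)] [∀ i, Nonempty (A i)]
    (u : Fin n → (∀ j, A j) → ℝ) (hu : ∀ i a, u i a ∈ Set.Icc (-1 : ℝ) 1)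
    (N : Fin n → Finset (Fin n))
    (hN : ∀ i, DependsOn (u i) (insert i (N i : Set (Fin n))))
    (c : ℕ) (hc : 1 ≤ c) (hcn : c ≤ n - 1)
    (hN₁ : ∀ i, (N i).card ≤ c)
    (hN₂ : ∀ i, (Finset.univ.filter fun j => j ≠ i ∧ i ∈ N j).card ≤ c)
    (x : ∀ i, ℕ → A i → ℝ) (T : ℕ) (hT : 2 ≤ T) :
    (AllPlayersUseBMOFTRLLogBar (1 / (128 * c * maxSqrtActions A)) u x →
      ∑ i, playerSwapRegret T u x i ≤
        256 * c * maxSqrtActions A * (∑ j, (Fintype.card (A j) : ℝ) ^ 2) * Real.log T) ∧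
    (1 / (128 * √((c : ℝ) * n) * maxSqrtActions A) ≤ 1 / (128 * c * maxSqrtActions A)) ∧
    (AllPlayersUseBMOFTRLLogBar (1 / (128 * √((c : ℝ) * n) * maxSqrtActions A)) u x →
      (∀ i, playerSwapRegret T u x i ≤
        256 * maxSqrtActions A *
          (√((c : ℝ) * n) * (Fintype.card (A i) : ℝ) ^ 2 +
            √((c : ℝ) / n) * ∑ j, (Fintype.card (A j) : ℝ) ^ 2) * Real.log T) ∧
      ∀ m : ℕ, (∀ j, Fintype.card (A j) = m) →
        ∀ i, playerSwapRegret T u x i ≤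
          512 * √((c : ℝ) * n) * (m : ℝ) ^ (5 / 2 : ℝ) * Real.log T) := by
  have hu' : ∀ i a, |u i a| ≤ 1 := fun i a => abs_le.2 (hu i a)
  have hn : 0 < n := by omega
  have hn0 : (0 : ℝ) < n := by exact_mod_cast hn
  have hcn' : (c : ℝ) ≤ n := by exact_mod_cast (by omega : c ≤ n)
  have hc0 : (0 : ℝ) < c := by exact_mod_cast hc
  have hM : 0 < maxSqrtActions A :=
    (Real.sqrt_pos.2 (Nat.cast_pos.2 Fintype.card_pos)).trans_le
      (sqrt_card_le_maxSqrtActions (A := A) ⟨0, hn⟩)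
  have hκ : (c : ℝ) ≤ √((c : ℝ) * n) := Real.le_sqrt_of_sq_le (by nlinarith)
  have hdiv : (c : ℝ) / √((c : ℝ) * n) = √((c : ℝ) / n) := by
    rw [Real.sqrt_mul hc0.le, Real.sqrt_div hc0.le, ← div_div, Real.div_sqrt]
  refine ⟨fun h => (h.regret_bounds hu' hN hc le_rfl hN₁ hN₂ hM hT).1,
    one_div_le_one_div_of_le (by positivity) (by nlinarith), fun h => ?_⟩
  have hb := (h.regret_bounds hu' hN hc hκ hN₁ hN₂ hM hT).2
  rw [hdiv] at hb
  refine ⟨hb, fun m hm i => (hb i).trans_eq ?_⟩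
  have : Nonempty (Fin n) := ⟨i⟩
  have hMm : maxSqrtActions A = √(m : ℝ) := by simp [maxSqrtActions, hm]
  have hm0 : (0 : ℝ) < m := by rw [← hm i]; exact Nat.cast_pos.2 Fintype.card_pos
  have hpow : (m : ℝ) ^ (5 / 2 : ℝ) = √(m : ℝ) * (m : ℝ) ^ 2 := by
    rw [Real.sqrt_eq_rpow, ← Real.rpow_natCast, ← Real.rpow_add hm0]
    norm_num
  -- With equal action counts the two terms of the bound coincide, whence 512 = 2 · 256.
  have hsq : √((c : ℝ) / n) * n = √((c : ℝ) * n) := by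
    rw [← hdiv, div_mul_eq_mul_div, Real.div_sqrt]
  simp only [hm, Finset.sum_const, Finset.card_univ, Fintype.card_fin, nsmul_eq_mul]
  rw [hMm, hpow, ← mul_assoc (√((c : ℝ) / n)), hsq]
  ring
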